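/- For a finite simple graph $G$, a proper vertex colouring $f:V(G)\to C$ with a finite set of colours $C$, all of which are used, is called complete if for any two distinct colours $c_1,c_2\in C$ there is an edge $v_1v_2\in E(G)$ with $f(v_1)=c_1$ and $f(v_2)=c_2$. The achromatic number $\operatorname{achr}(G)$ is the maximum number of colours in a proper complete vertex colouring of $G$. Let $K_n$ denote the complete graph on $n$ vertices, and $\square$ the Cartesian product of graphs. If $q\ge 41$ is an odd integer, then $$\operatorname{achr}(K_6\,\square\,K_q)=2q+3.$$ -/

import Mathlib

namespace SimpleGraph

/-- A proper vertex colouring `f` of `G` with colour set `C` is *complete* if every colour of `C` is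
used and any two distinct colours of `C` appear at the ends of some edge of `G`. (The first condition
follows from the second when `C` has at least two elements.) -/
def IsCompleteColoring {V C : Type*} {G : SimpleGraph V} (f : G.Coloring C) : Prop :=
  Function.Surjective f ∧
    ∀ c₁ c₂ : C, c₁ ≠ c₂ → ∃ v₁ v₂ : V, G.Adj v₁ v₂ ∧ f v₁ = c₁ ∧ f v₂ = c₂

/-- The set of all `k` such that `G` has a proper complete vertex colouring with exactly
`k` colours. -/
def completeColoringNumbers {V : Type*} (G : SimpleGraph V) : Set ℕ :=
  {k | ∃ f : G.Coloring (Fin k), IsCompleteColoring f}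

/-- The achromatic number of a finite graph `G`: the maximum number of colours in a proper complete
vertex colouring of `G`. -/
noncomputable def achromaticNumber {V : Type*} [Finite V] (G : SimpleGraph V) : ℕ :=
  sSup (completeColoringNumbers G)

/-- The numbers of colours are bounded, so the supremum above is not a junk value. -/
theorem bddAbove_completeColoringNumbers {V : Type*} [Finite V] (G : SimpleGraph V) :
    BddAbove (completeColoringNumbers G) := by
  refine ⟨Nat.card V, ?_⟩
  rintro k ⟨f, hf, -⟩
  simpa using Nat.card_le_card_of_surjective f hf

/-- A colouring with the least possible number of colours is complete, so the numbers of colours form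
a nonempty set and the supremum is a maximum. -/
theorem isGreatest_achromaticNumber {V : Type*} [Finite V] (G : SimpleGraph V) :
    IsGreatest (completeColoringNumbers G) (achromaticNumber G) := by
  classical
  have hne : (completeColoringNumbers G).Nonempty := by
    have hex : ∃ n, G.Colorable n := by
      have := Fintype.ofFinite V
      exact ⟨_, G.colorable_of_fintype⟩
    obtain ⟨f⟩ := Nat.find_spec hex
    have key : ∀ {D : Type} [Finite D], G.Coloring D → Nat.find hex ≤ Nat.card D := by
      intro D _ g
      have := Fintype.ofFinite D
      exact Nat.find_min' hex (by simpa [Nat.card_eq_fintype_card] using g.colorable)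
    have hlt : ∀ c : Fin (Nat.find hex),
        Nat.card {x : Fin (Nat.find hex) // x ≠ c} < Nat.find hex := by
      intro c
      rw [Nat.card_eq_fintype_card]
      simpa using Fintype.card_subtype_lt (p := fun x => x ≠ c) (x := c) (by simp)
    refine ⟨Nat.find hex, f, ?_, ?_⟩
    · intro c
      by_contra! h
      have g : G.Coloring {x : Fin (Nat.find hex) // x ≠ c} :=
        Coloring.mk (fun v => ⟨f v, h v⟩) (fun {v w} hvw he => f.valid hvw (congrArg Subtype.val he))
      exact absurd (key g) (not_le.2 (hlt c))
    · intro c₁ c₂ hc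
      by_contra! h
      have g : G.Coloring {x : Fin (Nat.find hex) // x ≠ c₁} :=
        Coloring.mk (fun v => if hv : f v = c₁ then ⟨c₂, hc.symm⟩ else ⟨f v, hv⟩) (by
          intro v w hvw he
          have h1 := f.valid hvw
          have h2 := h v w hvw
          have h3 := h w v hvw.symm
          split_ifs at he with ha hb hb
          · exact h1 (ha.trans hb.symm)
          · exact h2 ha (congrArg Subtype.val he).symm
          · exact h3 hb (congrArg Subtype.val he)
          · exact h1 (congrArg Subtype.val he))
      exact absurd (key g) (not_le.2 (hlt c₁))
  exact ⟨Nat.sSup_mem hne (bddAbove_completeColoringNumbers G),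
    fun k hk => le_csSup (bddAbove_completeColoringNumbers G) hk⟩

end SimpleGraph

/-!
Write `R c ⊆ {0, …, 5}` for the set of rows of the `6 × q` grid in which the colour `c` occurs; since
the colouring is proper, `c` occurs `|R c|` times.

**Upper bound.** Every row lies in exactly `q` of the sets `R c`, and for every `c` at most
`|R c| (6 - |R c|)` colours `d` have `R d` disjoint from `R c`, because such a `d` has to meet `c`
inside one of the `|R c|` columns of `c`, in a row outside `R c`. The bound uses only these two
facts, recorded in `IsRowSystem`. Suppose that there are at least `2q + 4` colours. Then `|R c| ≥ 2`
for all `c`, and at least `12` colours have `|R c| = 2`. Call these sets edges. If `{i, j}` is an edge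
then at most `8` colours avoid both rows, so by inclusion-exclusion at most `4` colours occur in
both rows. Hence almost all sets `R c` are independent in the graph of edges, and this leaves
little room: the graph has no triangle (`no_triangle`), no vertex of degree three
(`not_three_neighbours`) and none of degree two (`not_two_neighbours`). So it is a matching, and as
each edge carries at most `4` colours, it is a perfect matching whose three edges carry exactly `4`
colours each. All other colours are then transversal triples of the matching. These eight
triples form two families of four, one consisting of the complements of the other. The row counts
force the differences of the numbers of colours on a triple of one family and on its complement to
be all the same, while complementary triples that both occur carry at most `9` colours each.
For `q ≥ 41` this is possible only if `q` is even (`even_of_transversal_counts`).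

**Lower bound.** For `q = 2p + 3`, take three colours on each of the row pairs `01`, `23`, `45`, all
placed in the same three columns so that each occupies two of the three; any two of them share a row
or a column. Fill the other `2p` columns with `p` colours on each of the triples `024`, `035`,
`125`, `134`. Any two of these triples share a row, and each of them meets each of the row pairs.
-/

section RowSystem

open Finset

/-! ### Systems of row sets -/

/-- The numerical facts about the sets `R c` of rows occupied by the colours `c` of a proper complete
colouring of `K₆ □ K_q`: every row contains `q` colours, and the colours whose row set is disjoint
from `R c` all occur in the columns of `c`, in rows outside `R c`. -/
structure IsRowSystem {C : Type*} [Fintype C] (q : ℕ) (R : C → Finset (Fin 6)) : Prop where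
  card_row : ∀ i, #{c | i ∈ R c} = q
  card_disjoint : ∀ c, #{d | Disjoint (R d) (R c)} ≤ #(R c) * (6 - #(R c))

namespace IsRowSystem

variable {C : Type*} [Fintype C] {q : ℕ} {R : C → Finset (Fin 6)}

/-- Rows may be renumbered. -/
theorem map (h : IsRowSystem q R) (σ : Equiv.Perm (Fin 6)) :
    IsRowSystem q (fun c => (R c).map σ.toEmbedding) where
  card_row i := by
    rw [← h.card_row (σ.symm i)]
    congr! 2 with c
    simp [Finset.mem_map_equiv]
  card_disjoint c := by simpa [Finset.disjoint_map] using h.card_disjoint c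

theorem sum_card (h : IsRowSystem q R) : ∑ c, #(R c) = 6 * q := by
  have : ∀ c, #(R c) = ∑ i, if i ∈ R c then 1 else 0 := by simp
  simp only [this]
  rw [Finset.sum_comm]
  simp [h.card_row]

theorem two_le_card (h : IsRowSystem q R) (hq : 2 ≤ q) (hk : 2 * q + 4 ≤ Fintype.card C) (c : C) :
    2 ≤ #(R c) := by
  have hc := h.card_disjoint c
  by_contra! hlt
  interval_cases hR : #(R c)
  · rw [Finset.card_eq_zero] at hR
    simp [hR] at hc
    omega
  · obtain ⟨i, hi⟩ := Finset.card_eq_one.1 hR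
    have h1 := h.card_row i
    have h2 := Finset.card_filter_add_card_filter_not (s := (univ : Finset C)) (fun c => i ∈ R c)
    simp [hi] at hc h2
    omega

/-- Inclusion-exclusion for two rows. -/
theorem card_add_card_common (h : IsRowSystem q R) (i j : Fin 6) :
    Fintype.card C + #{d | i ∈ R d ∧ j ∈ R d} = 2 * q + #{d | i ∉ R d ∧ j ∉ R d} := by
  have : ∑ c, (1 + if i ∈ R c ∧ j ∈ R c then 1 else 0) =
      ∑ c, ((if i ∈ R c then 1 else 0) + (if j ∈ R c then 1 else 0) +
        if i ∉ R c ∧ j ∉ R c then 1 else 0) := by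
    refine Finset.sum_congr rfl fun c _ => ?_
    by_cases i ∈ R c <;> by_cases j ∈ R c <;> simp [*]
  simp only [Finset.sum_add_distrib, ← Finset.card_filter, h.card_row, Finset.sum_const,
    Finset.card_univ, smul_eq_mul] at this
  omega

theorem card_disjoint_pair (h : IsRowSystem q R) {i j : Fin 6} (hij : i ≠ j)
    (he : ∃ c, R c = {i, j}) : #{d | i ∉ R d ∧ j ∉ R d} ≤ 8 := by
  obtain ⟨c, hc⟩ := he
  simpa [hc, Finset.card_pair hij] using h.card_disjoint c

theorem card_common (h : IsRowSystem q R) (hk : 2 * q + 4 ≤ Fintype.card C) {i j : Fin 6}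
    (hij : i ≠ j) (he : ∃ c, R c = {i, j}) : #{d | i ∈ R d ∧ j ∈ R d} ≤ 4 := by
  have h8 := h.card_disjoint_pair hij he
  have := h.card_add_card_common i j
  omega

theorem card_pair_le (h : IsRowSystem q R) (hk : 2 * q + 4 ≤ Fintype.card C) {i j : Fin 6}
    (hij : i ≠ j) : #{d | R d = {i, j}} ≤ 4 := by
  by_cases he : ∃ c, R c = {i, j}
  · refine le_trans (Finset.card_le_card fun d => ?_) (h.card_common hk hij he)
    simp +contextual
  · push Not at he
    simp [he]

/-- Complementary triples: if `{i, j, l}` is a row set, few row sets avoid it. -/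
theorem card_triple (h : IsRowSystem q R) {i j l : Fin 6} (hc : #{i, j, l} = 3)
    (he : ∃ c, R c = {i, j, l}) : #{d | i ∉ R d ∧ j ∉ R d ∧ l ∉ R d} ≤ 9 := by
  obtain ⟨c, hc'⟩ := he
  simpa [hc', hc] using h.card_disjoint c

theorem exists_perm {n : ℕ} {f g : Fin n → Fin 6} (hf : f.Injective) (hg : g.Injective) :
    ∃ σ : Equiv.Perm (Fin 6), ∀ a, σ (f a) = g a := by
  obtain ⟨σ, hσ⟩ := (Equiv.Perm.isMultiplyPretransitive (Fin 6) n).exists_smul_eq ⟨f, hf⟩ ⟨g, hg⟩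
  exact ⟨σ, fun a => DFunLike.congr_fun hσ a⟩

/-- The three rows of a triangle of edges would contain at least `3q - 12` distinct colours. -/
theorem no_triangle (h : IsRowSystem q R) (hq : 41 ≤ q) (hk : 2 * q + 4 ≤ Fintype.card C)
    {i j l : Fin 6} (hij : i ≠ j) (hil : i ≠ l) (hjl : j ≠ l) (h1 : ∃ c, R c = {i, j})
    (h2 : ∃ c, R c = {i, l}) (h3 : ∃ c, R c = {j, l}) : False := by
  have m1 := h.card_common hk hij h1
  have m2 := h.card_common hk hil h2
  have m3 := h.card_common hk hjl h3
  have d1 := h.card_disjoint_pair hij h1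
  have : ∑ c, ((if i ∈ R c then 1 else 0) + (if j ∈ R c then 1 else 0) +
      (if l ∈ R c then 1 else 0)) ≤ ∑ c, (1 + (if i ∈ R c ∧ j ∈ R c then 1 else 0) +
      (if i ∈ R c ∧ l ∈ R c then 1 else 0) + (if j ∈ R c ∧ l ∈ R c then 1 else 0)) := by
    refine Finset.sum_le_sum fun c _ => ?_
    by_cases i ∈ R c <;> by_cases j ∈ R c <;> by_cases l ∈ R c <;> simp [*]
  simp only [Finset.sum_add_distrib, ← Finset.card_filter, h.card_row, Finset.sum_const,
    Finset.card_univ, smul_eq_mul] at this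
  have := h.card_add_card_common i j
  omega

/-- A pointwise inequality between weights on the subsets of `Fin 6` can be summed over the colours.
The counting arguments below consist of such inequalities, checked over the 64 subsets. -/
theorem sum_le (R : C → Finset (Fin 6)) {w w' : Finset (Fin 6) → ℕ} (h : ∀ T, w T ≤ w' T) :
    ∑ c, w (R c) ≤ ∑ c, w' (R c) :=
  Finset.sum_le_sum fun c _ => h (R c)

set_option maxRecDepth 100000 in
/-- Suppose that row `0` has the neighbours `1, 2, 3`. Let `A` be the colours avoiding row `0` and
lying in rows `1, 2, 3`, and `B` those lying in row `0` and avoiding rows `1, 2, 3`. Then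
`|A| ≥ q - 20` and `|B| ≥ q - 12`. If `{1, 2, 3}` were a row set, `B` would be small; so every
colour of `A` occurs at least four times, which forces more than `28` colours occurring twice.
But at most `8` of these avoid the edge `{0, 1}`, and at most five edges meet it, including `{0, 1}` itself, each
carrying at most `4` colours. -/
theorem not_three_neighbours_zero (h : IsRowSystem q R) (hq : 41 ≤ q)
    (hk : 2 * q + 4 ≤ Fintype.card C)
    (h1 : ∃ c, R c = {0, 1}) (h2 : ∃ c, R c = {0, 2}) (h3 : ∃ c, R c = {0, 3}) : False := by
  have two := h.two_le_card (by omega) hk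
  have m1 := h.card_common hk (by decide) h1
  have m2 := h.card_common hk (by decide) h2
  have m3 := h.card_common hk (by decide) h3
  have d1 := h.card_disjoint_pair (by decide) h1
  have d2 := h.card_disjoint_pair (by decide) h2
  have d3 := h.card_disjoint_pair (by decide) h3
  have n01 := h.card_pair_le hk (show (0 : Fin 6) ≠ 1 by decide)
  have n02 := h.card_pair_le hk (show (0 : Fin 6) ≠ 2 by decide)
  have n03 := h.card_pair_le hk (show (0 : Fin 6) ≠ 3 by decide)
  have n04 := h.card_pair_le hk (show (0 : Fin 6) ≠ 4 by decide)
  have n05 := h.card_pair_le hk (show (0 : Fin 6) ≠ 5 by decide)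
  have n14 := h.card_pair_le hk (show (1 : Fin 6) ≠ 4 by decide)
  have n15 := h.card_pair_le hk (show (1 : Fin 6) ≠ 5 by decide)
  have hA := sum_le R
    (w := fun T => 1)
    (w' := fun T => (if 0 ∈ T then 1 else 0) + (if 0 ∉ T ∧ 1 ∈ T ∧ 2 ∈ T ∧ 3 ∈ T then 1 else 0) +
      (if 0 ∉ T ∧ 1 ∉ T then 1 else 0) + (if 0 ∉ T ∧ 2 ∉ T then 1 else 0) +
      (if 0 ∉ T ∧ 3 ∉ T then 1 else 0)) (by decide)
  have hB := sum_le R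
    (w := fun T => if 0 ∈ T then 1 else 0)
    (w' := fun T => (if 0 ∈ T ∧ 1 ∉ T ∧ 2 ∉ T ∧ 3 ∉ T then 1 else 0) +
      (if 0 ∈ T ∧ 1 ∈ T then 1 else 0) + (if 0 ∈ T ∧ 2 ∈ T then 1 else 0) +
      (if 0 ∈ T ∧ 3 ∈ T then 1 else 0)) (by decide)
  simp only [Finset.sum_add_distrib, ← Finset.card_filter, h.card_row, Finset.sum_const,
    Finset.card_univ, smul_eq_mul] at hA hB
  -- All of `B` has row sets inside `{0, 4, 5}`, the complement of `{1, 2, 3}`.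
  have x123 : ∀ c, R c ≠ {1, 2, 3} := by
    intro c hc
    have := h.card_triple (by decide) ⟨c, hc⟩
    have : #{c | 0 ∈ R c ∧ 1 ∉ R c ∧ 2 ∉ R c ∧ 3 ∉ R c} ≤ _ :=
      (Finset.card_le_card fun d => by simp +contextual).trans this
    omega
  have x12 : ∀ c, R c ≠ {1, 2} := fun c hc =>
    h.no_triangle hq hk (by decide) (by decide) (by decide) h1 h2 ⟨c, hc⟩
  have x13 : ∀ c, R c ≠ {1, 3} := fun c hc =>
    h.no_triangle hq hk (by decide) (by decide) (by decide) h1 h3 ⟨c, hc⟩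
  -- With a fourth neighbour of row `0`, the at least `29` colours of `B` would be at most `8`.
  have x04 : ∀ c, R c ≠ {0, 4} := by
    intro c hc
    have m4 := h.card_common hk (by decide) ⟨c, hc⟩
    have pB : ∀ T : Finset (Fin 6), 2 ≤ #T →
        (if 0 ∈ T ∧ 1 ∉ T ∧ 2 ∉ T ∧ 3 ∉ T then 1 else 0) ≤
        (if 0 ∈ T ∧ 4 ∈ T then 1 else 0) + (if T = {0, 5} then 1 else 0) := by decide
    have cB := Finset.sum_le_sum fun c (_ : c ∈ univ) => pB (R c) (two c)
    simp only [Finset.sum_add_distrib, ← Finset.card_filter] at cB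
    omega
  have x05 : ∀ c, R c ≠ {0, 5} := by
    intro c hc
    have m5 := h.card_common hk (by decide) ⟨c, hc⟩
    have pB : ∀ T : Finset (Fin 6), 2 ≤ #T →
        (if 0 ∈ T ∧ 1 ∉ T ∧ 2 ∉ T ∧ 3 ∉ T then 1 else 0) ≤
        (if 0 ∈ T ∧ 5 ∈ T then 1 else 0) + (if T = {0, 4} then 1 else 0) := by decide
    have cB := Finset.sum_le_sum fun c (_ : c ∈ univ) => pB (R c) (two c)
    simp only [Finset.sum_add_distrib, ← Finset.card_filter] at cB
    omega
  have p2 : ∀ T : Finset (Fin 6), T ≠ {1, 2} → T ≠ {1, 3} → T ≠ {0, 4} → T ≠ {0, 5} →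
      (if #T = 2 then 1 else 0) ≤
      (if T = {0, 1} then 1 else 0) + (if T = {0, 2} then 1 else 0) +
      (if T = {0, 3} then 1 else 0) + (if T = {1, 4} then 1 else 0) +
      (if T = {1, 5} then 1 else 0) + (if 0 ∉ T ∧ 1 ∉ T then 1 else 0) := by decide
  have c2 := Finset.sum_le_sum fun c (_ : c ∈ univ) => p2 (R c) (x12 c) (x13 c) (x04 c) (x05 c)
  -- The row sets have average size below three, so larger sets are compensated by pairs.
  have pA : ∀ T : Finset (Fin 6), 2 ≤ #T → T ≠ {1, 2, 3} →
      (if 0 ∉ T ∧ 1 ∈ T ∧ 2 ∈ T ∧ 3 ∈ T then 1 else 0) + 3 ≤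
      #T + (if #T = 2 then 1 else 0) := by decide
  have cA := Finset.sum_le_sum fun c (_ : c ∈ univ) => pA (R c) (two c) (x123 c)
  simp only [Finset.sum_add_distrib, ← Finset.card_filter, h.sum_card, Finset.sum_const,
    Finset.card_univ, smul_eq_mul] at c2 cA
  omega

theorem exists_map_eq_pair {C : Type*} {R : C → Finset (Fin 6)} {i j : Fin 6}
    (σ : Equiv.Perm (Fin 6)) (h : ∃ c, R c = {i, j}) :
    ∃ c, (R c).map σ.toEmbedding = {σ i, σ j} := by
  obtain ⟨c, hc⟩ := h
  exact ⟨c, by simp [hc]⟩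

theorem not_three_neighbours (h : IsRowSystem q R) (hq : 41 ≤ q)
    (hk : 2 * q + 4 ≤ Fintype.card C) {i j l p : Fin 6} (hinj : Function.Injective ![i, j, l, p])
    (h1 : ∃ c, R c = {i, j}) (h2 : ∃ c, R c = {i, l}) (h3 : ∃ c, R c = {i, p}) : False := by
  obtain ⟨σ, hσ⟩ := exists_perm hinj (show Function.Injective ![0, 1, 2, 3] by decide)
  obtain ⟨s0, s1, s2, s3⟩ : σ i = 0 ∧ σ j = 1 ∧ σ l = 2 ∧ σ p = 3 :=
    ⟨hσ 0, hσ 1, hσ 2, hσ 3⟩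
  have h1 := exists_map_eq_pair σ h1
  have h2 := exists_map_eq_pair σ h2
  have h3 := exists_map_eq_pair σ h3
  rw [s0, s1] at h1
  rw [s0, s2] at h2
  rw [s0, s3] at h3
  exact not_three_neighbours_zero (h.map σ) hq hk h1 h2 h3

set_option maxRecDepth 100000 in
/-- Suppose that row `0` has the neighbours `1, 2`, hence no others by `not_three_neighbours`.
Let `A` be the colours avoiding row `0` and lying in rows `1, 2`, and `B` those lying in row `0` and
avoiding rows `1, 2`, so that `|A| ≥ q - 12`, `|B| ≥ q - 8` and `|A| + |B| ≥ 2q - 20`. Apart from a few colours occurring at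
least four times, the row sets are `{1, 2, x}` in `A` and `{0, y, z}` in `B`, with
`{x, y, z} = {3, 4, 5}`. These are complementary, so that each of the six triples carries at most `9`
colours. More precisely, the colours on `{1, 2, x}` and on the edge `{1, x}` together number at most
`9`; if `n` colours lie on the edges `{1, 3}`, `{1, 4}`, `{1, 5}`, then at most `4 + n` colours occur
at least four times, and `|A| + |B| ≤ (27 - n) + 27 + (4 + n) = 58 < 2q - 20`. -/
theorem not_two_neighbours_zero (h : IsRowSystem q R) (hq : 41 ≤ q)
    (hk : 2 * q + 4 ≤ Fintype.card C)
    (h1 : ∃ c, R c = {0, 1}) (h2 : ∃ c, R c = {0, 2}) : False := by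
  have two := h.two_le_card (by omega) hk
  have m1 := h.card_common hk (by decide) h1
  have m2 := h.card_common hk (by decide) h2
  have d1 := h.card_disjoint_pair (by decide) h1
  have d2 := h.card_disjoint_pair (by decide) h2
  have n01 := h.card_pair_le hk (show (0 : Fin 6) ≠ 1 by decide)
  have n02 := h.card_pair_le hk (show (0 : Fin 6) ≠ 2 by decide)
  -- Row `1` has at most one neighbour besides `0`.
  have n1 : #{c | R c = {1, 3}} + #{c | R c = {1, 4}} + #{c | R c = {1, 5}} ≤ 4 := by
    have n13 := h.card_pair_le hk (show (1 : Fin 6) ≠ 3 by decide)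
    have n14 := h.card_pair_le hk (show (1 : Fin 6) ≠ 4 by decide)
    have n15 := h.card_pair_le hk (show (1 : Fin 6) ≠ 5 by decide)
    rw [Finset.pair_comm] at h1
    have e (x : Fin 6) (hx : ¬ ∃ c, R c = {1, x}) : #{c | R c = {1, x}} = 0 := by
      push Not at hx
      simp [hx]
    by_cases e3 : ∃ c, R c = {1, 3}
    · have := e 4 fun e4 => h.not_three_neighbours hq hk (by decide) h1 e3 e4
      have := e 5 fun e5 => h.not_three_neighbours hq hk (by decide) h1 e3 e5
      omega
    · have := e 3 e3
      by_cases e4 : ∃ c, R c = {1, 4}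
      · have := e 5 fun e5 => h.not_three_neighbours hq hk (by decide) h1 e4 e5
        omega
      · have := e 4 e4
        omega
  have x12 : ∀ c, R c ≠ {1, 2} := fun c hc =>
    h.no_triangle hq hk (by decide) (by decide) (by decide) h1 h2 ⟨c, hc⟩
  have x03 : ∀ c, R c ≠ {0, 3} := fun c hc =>
    h.not_three_neighbours hq hk (by decide) h1 h2 ⟨c, hc⟩
  have x04 : ∀ c, R c ≠ {0, 4} := fun c hc =>
    h.not_three_neighbours hq hk (by decide) h1 h2 ⟨c, hc⟩
  have x05 : ∀ c, R c ≠ {0, 5} := fun c hc =>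
    h.not_three_neighbours hq hk (by decide) h1 h2 ⟨c, hc⟩
  have hA := sum_le R
    (w := fun T => 1)
    (w' := fun T => (if 0 ∈ T then 1 else 0) + (if 0 ∉ T ∧ 1 ∈ T ∧ 2 ∈ T then 1 else 0) +
      (if 0 ∉ T ∧ 1 ∉ T then 1 else 0) + (if 0 ∉ T ∧ 2 ∉ T then 1 else 0)) (by decide)
  have hB := sum_le R
    (w := fun T => if 0 ∈ T then 1 else 0)
    (w' := fun T => (if 0 ∈ T ∧ 1 ∉ T ∧ 2 ∉ T then 1 else 0) +
      (if 0 ∈ T ∧ 1 ∈ T then 1 else 0) + (if 0 ∈ T ∧ 2 ∈ T then 1 else 0)) (by decide)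
  have p2 : ∀ T : Finset (Fin 6), T ≠ {1, 2} → T ≠ {0, 3} → T ≠ {0, 4} → T ≠ {0, 5} →
      (if #T = 2 then 1 else 0) ≤
      (if T = {0, 1} then 1 else 0) + (if T = {0, 2} then 1 else 0) +
      (if T = {1, 3} then 1 else 0) + (if T = {1, 4} then 1 else 0) +
      (if T = {1, 5} then 1 else 0) + (if 0 ∉ T ∧ 1 ∉ T then 1 else 0) := by decide
  have c2 := Finset.sum_le_sum fun c (_ : c ∈ univ) => p2 (R c) (x12 c) (x03 c) (x04 c) (x05 c)
  -- Colours occurring at least four times are compensated by colours occurring twice.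
  have p4 : ∀ T : Finset (Fin 6), 2 ≤ #T →
      (if 4 ≤ #T then 1 else 0) + 3 ≤ #T + (if #T = 2 then 1 else 0) := by decide
  have c4 := Finset.sum_le_sum fun c (_ : c ∈ univ) => p4 (R c) (two c)
  have pAB : ∀ T : Finset (Fin 6), 2 ≤ #T → T ≠ {1, 2} → T ≠ {0, 3} → T ≠ {0, 4} → T ≠ {0, 5} →
      (if 0 ∉ T ∧ 1 ∈ T ∧ 2 ∈ T then 1 else 0) + (if 0 ∈ T ∧ 1 ∉ T ∧ 2 ∉ T then 1 else 0) ≤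
      (if T = {1, 2, 3} then 1 else 0) + (if T = {1, 2, 4} then 1 else 0) +
      (if T = {1, 2, 5} then 1 else 0) + (if T = {0, 4, 5} then 1 else 0) +
      (if T = {0, 3, 5} then 1 else 0) + (if T = {0, 3, 4} then 1 else 0) +
      (if 4 ≤ #T then 1 else 0) := by decide
  have pA : ∀ T : Finset (Fin 6), T ≠ {1, 2} →
      (if 0 ∉ T ∧ 1 ∈ T ∧ 2 ∈ T then 1 else 0) ≤
      (if T = {1, 2, 3} then 1 else 0) + (if T = {1, 2, 4} then 1 else 0) +
      (if T = {1, 2, 5} then 1 else 0) + (if 4 ≤ #T then 1 else 0) := by decide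
  have pB : ∀ T : Finset (Fin 6), 2 ≤ #T → T ≠ {0, 3} → T ≠ {0, 4} → T ≠ {0, 5} →
      (if 0 ∈ T ∧ 1 ∉ T ∧ 2 ∉ T then 1 else 0) ≤
      (if T = {0, 4, 5} then 1 else 0) +
      (if T = {0, 3, 5} then 1 else 0) + (if T = {0, 3, 4} then 1 else 0) +
      (if 4 ≤ #T then 1 else 0) := by decide
  have cAB := Finset.sum_le_sum fun c (_ : c ∈ univ) =>
    pAB (R c) (two c) (x12 c) (x03 c) (x04 c) (x05 c)
  have cA := Finset.sum_le_sum fun c (_ : c ∈ univ) => pA (R c) (x12 c)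
  have cB := Finset.sum_le_sum fun c (_ : c ∈ univ) => pB (R c) (two c) (x03 c) (x04 c) (x05 c)
  simp only [Finset.sum_add_distrib, ← Finset.card_filter, h.card_row, h.sum_card,
    Finset.sum_const, Finset.card_univ, smul_eq_mul] at hA hB c2 c4 cAB cA cB
  -- The triples `t = (x, y, z)` list the ways of choosing `x` from `{3, 4, 5}`.
  have key : ∀ t ∈ ({(3, 4, 5), (4, 3, 5), (5, 3, 4)} : Finset (Fin 6 × Fin 6 × Fin 6)),
      #{c | R c = {1, 2, t.1}} ≤ 9 ∧
      (0 < #{c | R c = {1, 2, t.1}} → #{c | R c = {0, t.2.1, t.2.2}} ≤ 9) ∧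
      (0 < #{c | R c = {0, t.2.1, t.2.2}} →
        #{c | R c = {1, 2, t.1}} + #{c | R c = {1, t.1}} ≤ 9) := by
    have fin : ∀ t ∈ ({(3, 4, 5), (4, 3, 5), (5, 3, 4)} : Finset (Fin 6 × Fin 6 × Fin 6)),
        #{1, 2, t.1} = 3 ∧ #{0, t.2.1, t.2.2} = 3 ∧ ∀ T : Finset (Fin 6),
          (if T = {1, 2, t.1} then 1 else 0) + (if T = {1, t.1} then 1 else 0) ≤
            (if 0 ∉ T ∧ t.2.1 ∉ T ∧ t.2.2 ∉ T then 1 else 0) ∧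
          (if T = {0, t.2.1, t.2.2} then 1 else 0) ≤
            (if 1 ∉ T ∧ 2 ∉ T ∧ t.1 ∉ T then 1 else 0) ∧
          (2 ≤ #T → T ∉ ({{0, 3}, {0, 4}, {0, 5}, {0, t.2.1, t.2.2}} : Finset (Finset (Fin 6))) →
            (if T = {1, 2, t.1} then 1 else 0) + (if 0 ∈ T ∧ 1 ∉ T ∧ 2 ∉ T then 1 else 0) ≤
            (if t.1 ∈ T then 1 else 0)) := by decide
    intro t ht
    obtain ⟨f1, f2, f3⟩ := fin t ht
    have u1 : 0 < #{c | R c = {0, t.2.1, t.2.2}} →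
        #{c | R c = {1, 2, t.1}} + #{c | R c = {1, t.1}} ≤ 9 := by
      intro hpos
      obtain ⟨c, hc⟩ := Finset.card_pos.1 hpos
      have u := h.card_triple f2 ⟨c, (Finset.mem_filter.1 hc).2⟩
      have := sum_le R fun T => (f3 T).1
      simp only [Finset.sum_add_distrib, ← Finset.card_filter] at this
      omega
    refine ⟨?_, fun hpos => ?_, u1⟩
    -- If no row set is `{0, y, z}`, row `x` contains all of `B` and has room for at most `8` more.
    · by_cases hpos : 0 < #{c | R c = {0, t.2.1, t.2.2}}
      · have := u1 hpos
        omega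
      · have hne : ∀ c, R c ≠ {0, t.2.1, t.2.2} := by simpa using hpos
        have := Finset.sum_le_sum fun c (_ : c ∈ univ) =>
          (f3 (R c)).2.2 (two c) (by simp [x03, x04, x05, hne])
        simp only [Finset.sum_add_distrib, ← Finset.card_filter, h.card_row] at this
        omega
    · obtain ⟨c, hc⟩ := Finset.card_pos.1 hpos
      have u := h.card_triple f1 ⟨c, (Finset.mem_filter.1 hc).2⟩
      have := sum_le R fun T => (f3 T).2.1
      simp only [← Finset.card_filter] at this
      omega
  obtain ⟨a3, b3, b3'⟩ := key (3, 4, 5) (by decide)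
  obtain ⟨a4, b4, b4'⟩ := key (4, 3, 5) (by decide)
  obtain ⟨a5, b5, b5'⟩ := key (5, 3, 4) (by decide)
  dsimp only at a3 b3 b3' a4 b4 b4' a5 b5 b5'
  -- As `A` and `B` are too large for two of their three types, all six triples occur.
  replace b3 := b3 (by omega)
  replace b4 := b4 (by omega)
  replace b5 := b5 (by omega)
  replace b3' := b3' (by omega)
  replace b4' := b4' (by omega)
  replace b5' := b5' (by omega)
  omega

theorem not_two_neighbours (h : IsRowSystem q R) (hq : 41 ≤ q)
    (hk : 2 * q + 4 ≤ Fintype.card C) {i j l : Fin 6} (hinj : Function.Injective ![i, j, l])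
    (h1 : ∃ c, R c = {i, j}) (h2 : ∃ c, R c = {i, l}) : False := by
  obtain ⟨σ, hσ⟩ := exists_perm hinj (show Function.Injective ![0, 1, 2] by decide)
  obtain ⟨s0, s1, s2⟩ : σ i = 0 ∧ σ j = 1 ∧ σ l = 2 := ⟨hσ 0, hσ 1, hσ 2⟩
  have h1 := exists_map_eq_pair σ h1
  have h2 := exists_map_eq_pair σ h2
  rw [s0, s1] at h1
  rw [s0, s2] at h2
  exact not_two_neighbours_zero (h.map σ) hq hk h1 h2

/-- The edges form a matching. -/
theorem eq_or_disjoint_of_card_eq_two (h : IsRowSystem q R) (hq : 41 ≤ q)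
    (hk : 2 * q + 4 ≤ Fintype.card C) {c d : C} (hc : #(R c) = 2) (hd : #(R d) = 2) :
    R c = R d ∨ Disjoint (R c) (R d) := by
  have key : ∀ S : Finset (Fin 6), #S = 2 → ∀ i ∈ S, ∃ j, i ≠ j ∧ S = {i, j} := by decide
  by_contra! hcd
  obtain ⟨i, hic, hid⟩ := Finset.not_disjoint_iff.1 hcd.2
  obtain ⟨j, hij, hj⟩ := key _ hc i hic
  obtain ⟨l, hil, hl⟩ := key _ hd i hid
  have hjl : j ≠ l := by
    rintro rfl
    exact hcd.1 (hj.trans hl.symm)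
  refine h.not_two_neighbours hq hk ?_ ⟨c, hj⟩ ⟨d, hl⟩
  intro a b
  fin_cases a <;> fin_cases b <;> simp [hij, hil, hjl, hij.symm, hil.symm, hjl.symm]

/-- A row set has average size `6q / |C| < 3`, so many colours occur twice, and all the more
if some occur at least four times. -/
theorem three_mul_card_le (h : IsRowSystem q R) (hq : 2 ≤ q)
    (hk : 2 * q + 4 ≤ Fintype.card C) :
    #{c | 4 ≤ #(R c)} + 3 * Fintype.card C ≤ 6 * q + #{c | #(R c) = 2} := by
  have := Finset.sum_le_sum fun c (_ : c ∈ univ) =>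
    show (if 4 ≤ #(R c) then 1 else 0) + 3 ≤ #(R c) + (if #(R c) = 2 then 1 else 0) by
      have := h.two_le_card hq hk c
      split_ifs <;> omega
  simp only [Finset.sum_add_distrib, ← Finset.card_filter, h.sum_card, Finset.sum_const,
    Finset.card_univ, smul_eq_mul] at this
  omega

/-- Here `a, b, c, d` count the colours on `{0, 2, 4}`, `{0, 3, 5}`, `{1, 2, 5}`, `{1, 3, 4}`, and
`a', b', c', d'` those on the complements; `r0`, …, `r3` count rows `0`, `1`, `2`, `4`. The row
counts give `a - a' = b - b' = c - c' = d - d'`. Call this `δ`. If `δ = 0` then all eight numbers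
are at most `9` and `q ≤ 40`. If `δ > 0` and `a', b', c', d'` vanish, then `q = 4 + 2a`; otherwise
`δ ≤ 8` and again `q ≤ 40`. The case `δ < 0` is symmetric. -/
theorem even_of_transversal_counts {q a b c d a' b' c' d' : ℕ}
    (hq : 41 ≤ q)
    (r0 : q = 4 + a + b + c' + d') (r1 : q = 4 + c + d + a' + b') (r2 : q = 4 + a + c + b' + d')
    (r3 : q = 4 + a + d + b' + c')
    (ha : 0 < a → a' ≤ 9) (ha' : 0 < a' → a ≤ 9) (hb : 0 < b → b' ≤ 9) (hb' : 0 < b' → b ≤ 9)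
    (hc : 0 < c → c' ≤ 9) (hc' : 0 < c' → c ≤ 9) (hd : 0 < d → d' ≤ 9) (hd' : 0 < d' → d ≤ 9) :
    Even q := by
  rcases lt_trichotomy a a' with hlt | heq | hlt
  · by_cases h0 : a = 0 ∧ b = 0 ∧ c = 0 ∧ d = 0
    · exact ⟨2 + a', by omega⟩
    · exfalso
      omega
  · exfalso
    omega
  · by_cases h0 : a' = 0 ∧ b' = 0 ∧ c' = 0 ∧ d' = 0
    · exact ⟨2 + a, by omega⟩
    · exfalso
      omega

theorem card_triple_le (h : IsRowSystem q R) {S T : Finset (Fin 6)} (hS : #S = 3) (hT : T = Sᶜ)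
    (hpos : 0 < #{c | R c = S}) : #{c | R c = T} ≤ 9 := by
  obtain ⟨c, hc⟩ := Finset.card_pos.1 hpos
  have u := h.card_disjoint c
  rw [(Finset.mem_filter.1 hc).2, hS] at u
  refine le_trans (Finset.card_le_card fun d => ?_) u
  simp +contextual [hT, disjoint_compl_left]

set_option maxRecDepth 100000 in
set_option synthInstance.maxSize 1000 in
set_option synthInstance.maxHeartbeats 200000 in
/-- With two edges `{0, 1}`, `{2, 3}` the third one is `{4, 5}`, and all inequalities used are tight:
each edge carries `4` colours and is contained in no larger row set, and no row set has more than
three elements. -/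
theorem even_of_two_edges (h : IsRowSystem q R) (hq : 41 ≤ q)
    (hk : 2 * q + 4 ≤ Fintype.card C) (h01 : ∃ c, R c = {0, 1}) (h23 : ∃ c, R c = {2, 3}) :
    Even q := by
  have two := h.two_le_card (by omega) hk
  have n01 := h.card_pair_le hk (show (0 : Fin 6) ≠ 1 by decide)
  have n23 := h.card_pair_le hk (show (2 : Fin 6) ≠ 3 by decide)
  have n45 := h.card_pair_le hk (show (4 : Fin 6) ≠ 5 by decide)
  have m01 := h.card_common hk (by decide) h01
  have m23 := h.card_common hk (by decide) h23
  have c4 := h.three_mul_card_le (by omega) hk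
  have pairs : ∀ c, #(R c) = 2 → R c = {0, 1} ∨ R c = {2, 3} ∨ R c = {4, 5} := by
    intro c hc
    obtain ⟨c₁, h₁⟩ := h01
    obtain ⟨c₂, h₂⟩ := h23
    have d₁ := h.eq_or_disjoint_of_card_eq_two hq hk hc (show #(R c₁) = 2 by rw [h₁]; rfl)
    have d₂ := h.eq_or_disjoint_of_card_eq_two hq hk hc (show #(R c₂) = 2 by rw [h₂]; rfl)
    rw [h₁] at d₁
    rw [h₂] at d₂
    generalize R c = T at *
    revert T
    decide
  have c2 := Finset.sum_le_sum fun c (_ : c ∈ univ) =>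
    show (if #(R c) = 2 then 1 else 0) ≤ (if R c = {0, 1} then 1 else 0) +
      (if R c = {2, 3} then 1 else 0) + (if R c = {4, 5} then 1 else 0) by
      have := pairs c
      split_ifs <;> first | omega | tauto
  simp only [Finset.sum_add_distrib, ← Finset.card_filter] at c2
  have h45 : ∃ c, R c = {4, 5} := by
    by_contra! hne
    have : #{c | R c = {4, 5}} = 0 := by simp [hne]
    omega
  have m45 := h.card_common hk (by decide) h45
  -- At most `12` colours occur twice, so the colours occurring at least four times have no room.
  have le3 : ∀ c, ¬ 4 ≤ #(R c) := by
    have : #{c | 4 ≤ #(R c)} = 0 := by omega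
    simpa using this
  have excl : ∀ {i j : Fin 6}, #{c | R c = {i, j}} = 4 → #{c | i ∈ R c ∧ j ∈ R c} ≤ 4 →
      ∀ c, i ∈ R c ∧ j ∈ R c → R c = {i, j} := by
    intro i j h1 h2 c hc
    have hsub : ({c | R c = {i, j}} : Finset C) ⊆ ({c | i ∈ R c ∧ j ∈ R c} : Finset C) := by
      intro d
      simp +contextual
    have := Finset.eq_of_subset_of_card_le hsub (by omega)
    have hmem : c ∈ ({c | i ∈ R c ∧ j ∈ R c} : Finset C) := by simpa using hc
    rw [← this] at hmem
    simpa using hmem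
  have e01 := excl (by omega) m01
  have e23 := excl (by omega) m23
  have e45 := excl (by omega) m45
  have types : ∀ T : Finset (Fin 6), 2 ≤ #T → ¬ 4 ≤ #T →
      (#T = 2 → T = {0, 1} ∨ T = {2, 3} ∨ T = {4, 5}) → (0 ∈ T ∧ 1 ∈ T → T = {0, 1}) →
      (2 ∈ T ∧ 3 ∈ T → T = {2, 3}) → (4 ∈ T ∧ 5 ∈ T → T = {4, 5}) →
      T ∈ ({{0, 1}, {2, 3}, {4, 5}, {0, 2, 4}, {0, 3, 5}, {1, 2, 5}, {1, 3, 4}, {1, 3, 5},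
        {1, 2, 4}, {0, 3, 4}, {0, 2, 5}} : Finset (Finset (Fin 6))) := by decide
  have rows : ∀ T ∈ ({{0, 1}, {2, 3}, {4, 5}, {0, 2, 4}, {0, 3, 5}, {1, 2, 5}, {1, 3, 4}, {1, 3, 5},
        {1, 2, 4}, {0, 3, 4}, {0, 2, 5}} : Finset (Finset (Fin 6))),
      ((if 0 ∈ T then 1 else 0) =
        (if T = {0, 1} then 1 else 0) + (if T = {0, 2, 4} then 1 else 0) +
        (if T = {0, 3, 5} then 1 else 0) + (if T = {0, 3, 4} then 1 else 0) +
        (if T = {0, 2, 5} then 1 else 0)) ∧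
      ((if 1 ∈ T then 1 else 0) =
        (if T = {0, 1} then 1 else 0) + (if T = {1, 2, 5} then 1 else 0) +
        (if T = {1, 3, 4} then 1 else 0) + (if T = {1, 3, 5} then 1 else 0) +
        (if T = {1, 2, 4} then 1 else 0)) ∧
      ((if 2 ∈ T then 1 else 0) =
        (if T = {2, 3} then 1 else 0) + (if T = {0, 2, 4} then 1 else 0) +
        (if T = {1, 2, 5} then 1 else 0) + (if T = {1, 2, 4} then 1 else 0) +
        (if T = {0, 2, 5} then 1 else 0)) ∧
      ((if 4 ∈ T then 1 else 0) =
        (if T = {4, 5} then 1 else 0) + (if T = {0, 2, 4} then 1 else 0) +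
        (if T = {1, 3, 4} then 1 else 0) + (if T = {1, 2, 4} then 1 else 0) +
        (if T = {0, 3, 4} then 1 else 0)) := by decide
  have rows c := rows (R c) <| types (R c) (two c) (le3 c) (pairs c) (e01 c) (e23 c) (e45 c)
  have row0 := Finset.sum_congr rfl fun c (_ : c ∈ univ) => (rows c).1
  have row1 := Finset.sum_congr rfl fun c (_ : c ∈ univ) => (rows c).2.1
  have row2 := Finset.sum_congr rfl fun c (_ : c ∈ univ) => (rows c).2.2.1
  have row4 := Finset.sum_congr rfl fun c (_ : c ∈ univ) => (rows c).2.2.2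
  simp only [Finset.sum_add_distrib, ← Finset.card_filter, h.card_row] at row0 row1 row2 row4
  have tr {S T : Finset (Fin 6)} (hS : #S = 3) (hT : T = Sᶜ) :=
    h.card_triple_le hS hT
  refine even_of_transversal_counts (a := #{c | R c = {0, 2, 4}}) (b := #{c | R c = {0, 3, 5}})
    (c := #{c | R c = {1, 2, 5}}) (d := #{c | R c = {1, 3, 4}}) (a' := #{c | R c = {1, 3, 5}})
    (b' := #{c | R c = {1, 2, 4}}) (c' := #{c | R c = {0, 3, 4}}) (d' := #{c | R c = {0, 2, 5}})
    hq (by omega) (by omega) (by omega) (by omega) (tr rfl (by decide)) (tr rfl (by decide))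
    (tr rfl (by decide)) (tr rfl (by decide)) (tr rfl (by decide)) (tr rfl (by decide))
    (tr rfl (by decide)) (tr rfl (by decide))

theorem card_le_two_mul_add_three (h : IsRowSystem q R) (hq : 41 ≤ q) (hodd : Odd q) :
    Fintype.card C ≤ 2 * q + 3 := by
  by_contra! hlt
  have hk : 2 * q + 4 ≤ Fintype.card C := hlt
  have c4 := h.three_mul_card_le (by omega) hk
  obtain ⟨c, hc⟩ : ∃ c, #(R c) = 2 := by
    by_contra! hne
    have : #{c | #(R c) = 2} = 0 := by simp [hne]
    omega
  obtain ⟨i, j, hij, hR⟩ := Finset.card_eq_two.1 hc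
  obtain ⟨d, hd, hcd⟩ : ∃ d, #(R d) = 2 ∧ R d ≠ R c := by
    by_contra! hne
    have := Finset.card_le_card (s := {d | #(R d) = 2}) (t := {d | R d = {i, j}}) fun d => by
      simpa [← hR] using hne d
    have := h.card_pair_le hk hij
    omega
  have hdisj := (h.eq_or_disjoint_of_card_eq_two hq hk hd hc).resolve_left hcd
  obtain ⟨l, p, hlp, hR'⟩ := Finset.card_eq_two.1 hd
  rw [hR, hR'] at hdisj
  obtain ⟨⟨hli, hpi⟩, hlj, hpj⟩ : (l ≠ i ∧ p ≠ i) ∧ l ≠ j ∧ p ≠ j := by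
    simpa [eq_comm] using hdisj
  have hinj : Function.Injective ![i, j, l, p] := by
    intro a b
    fin_cases a <;> fin_cases b <;> simp [hij, hlp, hli, hpi, hlj, hpj, hij.symm, hlp.symm,
      hli.symm, hpi.symm, hlj.symm, hpj.symm]
  obtain ⟨σ, hσ⟩ := exists_perm hinj (show Function.Injective ![0, 1, 2, 3] by decide)
  obtain ⟨s0, s1, s2, s3⟩ : σ i = 0 ∧ σ j = 1 ∧ σ l = 2 ∧ σ p = 3 :=
    ⟨hσ 0, hσ 1, hσ 2, hσ 3⟩
  have h1 := exists_map_eq_pair σ ⟨c, hR⟩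
  have h2 := exists_map_eq_pair σ ⟨d, hR'⟩
  rw [s0, s1] at h1
  rw [s2, s3] at h2
  exact Nat.not_even_iff_odd.2 hodd ((h.map σ).even_of_two_edges hq hk h1 h2)

end IsRowSystem

end RowSystem

namespace SimpleGraph

/-! ### Row sets of a complete colouring -/

section

open Finset

theorem IsCompleteColoring.isRowSystem {q : ℕ} {C : Type*} [Fintype C] [DecidableEq C]
    {f : (completeGraph (Fin 6) □ completeGraph (Fin q)).Coloring C} (hf : IsCompleteColoring f) :
    IsRowSystem q (fun c => ({i | ∃ x, f (i, x) = c} : Finset (Fin 6))) := by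
  have hrow : ∀ i, Function.Injective fun x => f (i, x) := by
    intro i x y hxy
    by_contra hne
    exact f.valid (show (completeGraph (Fin 6) □ completeGraph (Fin q)).Adj (i, x) (i, y) by
      simp [boxProd_adj, hne]) hxy
  constructor
  · intro i
    have : ({c | i ∈ ({i | ∃ x, f (i, x) = c} : Finset (Fin 6))} : Finset C) =
        univ.image fun x => f (i, x) := by
      ext c
      simp
    rw [this, Finset.card_image_of_injective _ (hrow i), Finset.card_univ, Fintype.card_fin]
  · intro c
    set S : Finset (Fin 6) := ({i | ∃ x, f (i, x) = c} : Finset (Fin 6)) with hS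
    have hx : ∀ i, ∃ x, i ∈ S → f (i, x) = c := by
      intro i
      by_cases hi : i ∈ S
      · obtain ⟨x, hx⟩ : ∃ x, f (i, x) = c := by simpa [hS] using hi
        exact ⟨x, fun _ => hx⟩
      · obtain ⟨⟨-, x⟩, -⟩ := hf.1 c
        exact ⟨x, fun h => absurd h hi⟩
    choose x hx using hx
    -- `x i` is the column of `c` in row `i`.
    calc _ ≤ #((S ×ˢ Sᶜ).image fun p => f (p.2, x p.1)) := by
            refine Finset.card_le_card fun d hd => ?_
            have hd : Disjoint ({i | ∃ x, f (i, x) = d} : Finset (Fin 6)) S := by simpa using hd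
            have hdc : d ≠ c := by
              rintro rfl
              obtain ⟨⟨i, y⟩, hy⟩ := hf.1 d
              exact Finset.disjoint_left.1 hd (show i ∈ _ by simpa using ⟨y, hy⟩)
                (by simpa [hS] using ⟨y, hy⟩)
            obtain ⟨⟨i, y⟩, ⟨j, z⟩, hadj, hi, hj⟩ := hf.2 d c hdc
            have hiS : i ∉ S := Finset.disjoint_left.1 hd (by simpa using ⟨y, hi⟩)
            have hjS : j ∈ S := by simpa [hS] using ⟨z, hj⟩
            rw [boxProd_adj] at hadj
            rcases hadj with ⟨-, hyz⟩ | ⟨-, hij⟩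
            · have hxz : x j = z := hrow j ((hx j hjS).trans hj.symm)
              refine Finset.mem_image.2 ⟨(j, i), by simp [hiS, hjS], ?_⟩
              simp only at hyz
              simp only [hxz, ← hyz, hi]
            · simp only at hij
              exact absurd (hij ▸ hjS) hiS
      _ ≤ #(S ×ˢ Sᶜ) := Finset.card_image_le
      _ = #S * (6 - #S) := by rw [Finset.card_product, Finset.card_compl, Fintype.card_fin]

end

/-! ### A complete colouring with `2q + 3` colours -/

/-- Any colour set with `k` elements may replace `Fin k`. -/
theorem IsCompleteColoring.mem_completeColoringNumbers {V C : Type*} [Fintype C]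
    {G : SimpleGraph V} {f : G.Coloring C} (hf : IsCompleteColoring f) {k : ℕ}
    (hk : Fintype.card C = k) : k ∈ completeColoringNumbers G := by
  obtain ⟨e⟩ : Nonempty (C ≃ Fin k) := ⟨Fintype.equivFinOfCardEq hk⟩
  refine ⟨Coloring.mk (fun v => e (f v)) fun {v w} hvw => e.injective.ne (f.valid hvw), ?_, ?_⟩
  · exact e.surjective.comp hf.1
  · intro c₁ c₂ hc
    obtain ⟨v, w, h, h1, h2⟩ := hf.2 (e.symm c₁) (e.symm c₂) (e.symm.injective.ne hc)
    exact ⟨v, w, h, by simp [Coloring.mk, h1], by simp [Coloring.mk, h2]⟩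

/-- Apart from the three special columns, the columns form two blocks. The triples `024`, `035`,
`125`, `134` are numbered `0, 1, 2, 3`, and `blockType i b` is the number of the triple whose colours
fill row `i` of block `b`. -/
def blockType : Fin 6 → Fin 2 → Fin 4 :=
  ![![0, 1], ![2, 3], ![0, 2], ![1, 3], ![0, 3], ![1, 2]]

/-- The cyclic shift of the colours in row `i` of block `b`. The rows of a block that are filled by
the same triple have different shifts, so that no colour is repeated in a column. -/
def blockShift : Fin 6 → Fin 2 → Fin 3 :=
  ![![0, 0], ![0, 0], ![1, 0], ![0, 1], ![2, 2], ![1, 1]]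

/-- The colour in row `i` of a given column, the columns being `Fin 3` (special columns) and
`Fin 2 × ZMod p` (two blocks). The colour `Sum.inl (t, u)` lives on the rows `2t` and `2t + 1`, in the
columns `u` and `u - 1` modulo `3`; the colour `Sum.inr (a, z)` lives on the rows of the `a`-th triple. -/
def transversalColour {p : ℕ} (i : Fin 6) :
    Fin 3 ⊕ Fin 2 × ZMod p → (Fin 3 × Fin 3) ⊕ (Fin 4 × ZMod p) :=
  Sum.map (fun x => (![0, 0, 1, 1, 2, 2] i, x + ![0, 1, 0, 1, 0, 1] i))
    fun y => (blockType i y.1, y.2 + ((blockShift i y.1 : ℕ) : ZMod p))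

theorem transversalColour_row_injective {p : ℕ} (i : Fin 6) :
    Function.Injective (transversalColour (p := p) i) := by
  refine Function.Injective.sumMap (fun x x' h => ?_) fun ⟨b, y⟩ ⟨b', y'⟩ h => ?_
  · simpa using h
  · have hb : ∀ i b b', blockType i b = blockType i b' → b = b' := by decide
    simp only [Prod.mk.injEq] at h
    obtain rfl := hb i b b' h.1
    simpa using h.2

theorem transversalColour_col_injective {p : ℕ} (hp : 3 ≤ p) (x : Fin 3 ⊕ Fin 2 × ZMod p) :
    Function.Injective fun i => transversalColour i x := by
  intro i j h
  rcases x with x | ⟨b, y⟩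
  · revert i j x
    simp only [transversalColour, Sum.map_inl, Sum.inl.injEq]
    decide
  · have hb : ∀ i j b, blockType i b = blockType j b → blockShift i b = blockShift j b → i = j := by
      decide
    simp only [transversalColour, Sum.map_inr, Sum.inr.injEq, Prod.mk.injEq, add_right_inj] at h
    refine hb i j b h.1 (Fin.ext ?_)
    have := (ZMod.natCast_eq_natCast_iff' _ _ _).1 h.2
    rwa [Nat.mod_eq_of_lt (by omega), Nat.mod_eq_of_lt (by omega)] at this

/-- The colouring `transversalColour`, with the columns identified with `Fin q` by means of `e`. -/
def transversalColoring {p : ℕ} (hp : 3 ≤ p) {q : ℕ} (e : Fin q ≃ Fin 3 ⊕ Fin 2 × ZMod p) :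
    (completeGraph (Fin 6) □ completeGraph (Fin q)).Coloring ((Fin 3 × Fin 3) ⊕ (Fin 4 × ZMod p)) :=
  Coloring.mk (fun v => transversalColour v.1 (e v.2)) <| by
    rintro ⟨i, x⟩ ⟨j, y⟩ hadj heq
    rcases hadj with ⟨hne, hxy⟩ | ⟨hne, hij⟩
    · obtain rfl : x = y := hxy
      exact hne (transversalColour_col_injective hp _ heq)
    · obtain rfl : i = j := hij
      exact hne (e.injective (transversalColour_row_injective _ heq))

theorem isCompleteColoring_transversalColoring {p : ℕ} (hp : 3 ≤ p) {q : ℕ}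
    (e : Fin q ≃ Fin 3 ⊕ Fin 2 × ZMod p) : IsCompleteColoring (transversalColoring hp e) := by
  have hinl : ∀ i u, ∃ x : Fin 3 ⊕ Fin 2 × ZMod p,
      transversalColour i x = .inl (![0, 0, 1, 1, 2, 2] i, u) := fun i u =>
    ⟨.inl (u - ![0, 1, 0, 1, 0, 1] i), by simp [transversalColour]⟩
  have hinr : ∀ i b z, ∃ x : Fin 3 ⊕ Fin 2 × ZMod p,
      transversalColour i x = .inr (blockType i b, z) := fun i b z =>
    ⟨.inr (b, z - ((blockShift i b : ℕ) : ZMod p)), by simp [transversalColour]⟩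
  have common_row : ∀ {i c d}, c ≠ d → (∃ x : Fin 3 ⊕ Fin 2 × ZMod p, transversalColour i x = c) →
      (∃ x : Fin 3 ⊕ Fin 2 × ZMod p, transversalColour i x = d) →
      ∃ v w, (completeGraph (Fin 6) □ completeGraph (Fin q)).Adj v w ∧
        transversalColoring hp e v = c ∧ transversalColoring hp e w = d := by
    rintro i c d hcd ⟨x, rfl⟩ ⟨y, rfl⟩
    refine ⟨(i, e.symm x), (i, e.symm y), Or.inr ⟨?_, rfl⟩, ?_, ?_⟩
    · rintro h
      exact hcd (congrArg _ (e.symm.injective h))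
    · exact congrArg (transversalColour i) (e.apply_symm_apply x)
    · exact congrArg (transversalColour i) (e.apply_symm_apply y)
  constructor
  · have rows : (∀ t : Fin 3, ∃ i : Fin 6, (![0, 0, 1, 1, 2, 2] : Fin 6 → Fin 3) i = t) ∧
        ∀ a, ∃ i b, blockType i b = a := by decide
    rintro (⟨t, u⟩ | ⟨a, z⟩)
    · obtain ⟨i, rfl⟩ := rows.1 t
      obtain ⟨x, hx⟩ := hinl i u
      exact ⟨(i, e.symm x), (congrArg (transversalColour i) (e.apply_symm_apply x)).trans hx⟩
    · obtain ⟨i, b, rfl⟩ := rows.2 a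
      obtain ⟨x, hx⟩ := hinr i b z
      exact ⟨(i, e.symm x), (congrArg (transversalColour i) (e.apply_symm_apply x)).trans hx⟩
  · have inl_inr : ∀ (t : Fin 3) (a : Fin 4), ∃ (i : Fin 6) (b : Fin 2),
        (![0, 0, 1, 1, 2, 2] : Fin 6 → Fin 3) i = t ∧ blockType i b = a := by decide
    rintro (⟨t, u⟩ | ⟨a, z⟩) (⟨t', u'⟩ | ⟨a', z'⟩) hne
    -- For `t ≠ t'`, each of the two colours occupies two of the three special columns.
    · by_cases htt : t = t'
      · subst htt
        have row : ∀ t : Fin 3, ∃ i : Fin 6, (![0, 0, 1, 1, 2, 2] : Fin 6 → Fin 3) i = t := by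
          decide
        obtain ⟨i, rfl⟩ := row t
        exact common_row hne (hinl i u) (hinl i u')
      · have col : ∀ t t' u u' : Fin 3, t ≠ t' → ∃ (i j : Fin 6) (x : Fin 3), i ≠ j ∧
            ((![0, 0, 1, 1, 2, 2] i, x + ![0, 1, 0, 1, 0, 1] i) : Fin 3 × Fin 3) = (t, u) ∧
            ((![0, 0, 1, 1, 2, 2] j, x + ![0, 1, 0, 1, 0, 1] j) : Fin 3 × Fin 3) = (t', u') := by
          decide
        obtain ⟨i, j, x, hij, h1, h2⟩ := col t t' u u' htt
        refine ⟨(i, e.symm (.inl x)), (j, e.symm (.inl x)), Or.inl ⟨hij, rfl⟩, ?_, ?_⟩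
        · exact (congrArg (transversalColour i) (e.apply_symm_apply _)).trans (congrArg Sum.inl h1)
        · exact (congrArg (transversalColour j) (e.apply_symm_apply _)).trans (congrArg Sum.inl h2)
    · obtain ⟨i, b, rfl, rfl⟩ := inl_inr t a'
      exact common_row hne (hinl i u) (hinr i b z')
    · obtain ⟨i, b, rfl, rfl⟩ := inl_inr t' a
      exact common_row hne (hinr i b z) (hinl i u')
    · have inr_inr : ∀ a a' : Fin 4, ∃ (i : Fin 6) (b b' : Fin 2),
          blockType i b = a ∧ blockType i b' = a' := by decide
      obtain ⟨i, b, b', rfl, rfl⟩ := inr_inr a a'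
      exact common_row hne (hinr i b z) (hinr i b' z')

end SimpleGraph

theorem theorem1 (q : ℕ) (hq : 41 ≤ q) (hodd : Odd q) :
    SimpleGraph.achromaticNumber
      (SimpleGraph.boxProd (SimpleGraph.completeGraph (Fin 6)) (SimpleGraph.completeGraph (Fin q))) =
      2 * q + 3 := by
  refine (SimpleGraph.isGreatest_achromaticNumber _).unique ⟨?_, ?_⟩
  · obtain ⟨p, hp⟩ : ∃ p, q = 2 * p + 3 := by
      obtain ⟨m, hm⟩ := hodd
      exact ⟨m - 1, by omega⟩
    have : NeZero p := ⟨by omega⟩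
    obtain ⟨e⟩ : Nonempty (Fin q ≃ Fin 3 ⊕ Fin 2 × ZMod p) :=
      Fintype.card_eq.1 (by simp [ZMod.card]; omega)
    refine (SimpleGraph.isCompleteColoring_transversalColoring (by omega)
      e).mem_completeColoringNumbers ?_
    simp [ZMod.card]
    omega
  · rintro k ⟨f, hf⟩
    simpa using hf.isRowSystem.card_le_two_mul_add_three hq hodd
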